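/- Let $q$ be even, let $\rho$ be a Hermitian polarity of $\mathsf{PG}(2,q^2)$, and let $X$ be the set of self-conjugate points of $\rho$, i.e. of points $P$ with $P\in P^\rho$. Two lines $\ell,m$ are called conjugate if $\ell^\rho\in m$; a line is self-conjugate if it is conjugate to itself. The Hermitian unital $\mathcal{H}(q)$ has $X$ as its set of points and the sets $\ell\cap X$, with $\ell$ a line that is not self-conjugate, as its blocks; any two of its points are connected by exactly one block. For blocks $b_1,b_2$ let $F_{\mathcal{H}(q)}(b_1,b_2)$ be the set of full points with respect to $(b_1,b_2)$, i.e. of the points $P\in X\setminus(b_1\cup b_2)$ such that for each $Q\in b_1$ the block connecting $P$ and $Q$ intersects $b_2$. Let $\ell_1,\ell_2$ be lines that are not self-conjugate, and let $b_i=\ell_i\cap X$ for $i=1,2$. (i) If $\ell_1,\ell_2$ are conjugate, then they meet in exactly one point and $F_{\mathcal{H}(q)}(b_1,b_2)=b_3$, where $b_3=\ell_3\cap X$ with $\ell_3=(\ell_1\cap\ell_2)^\rho$. Moreover $b_1,b_2,b_3$ form an embedded dual $3$-net of $\mathcal{H}(q)$: they are pairwise disjoint blocks, and for $i\neq j$,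 $P\in b_i$ and $Q\in b_j$, the block containing $P$ and $Q$ intersects each of $b_1,b_2,b_3$ in exactly one point. (ii) If $\ell_1,\ell_2$ are not conjugate, then either $b_1\cap b_2\neq\emptyset$, or $|F_{\mathcal{H}(q)}(b_1,b_2)|=1$. -/

import Mathlib

open scoped LinearAlgebra.Projectivization Matrix

/-- Points of the projective plane over `K`. -/
abbrev PlanePoint (K : Type*) [Field K] : Type _ := ℙ K (Fin 3 → K)

/-- Lines of the projective plane over `K`, in dual homogeneous coordinates: `P ∈ ℓ` is
Mathlib's incidence relation (`Configuration.ofField`), i.e. `∑ i, P i * ℓ i = 0`. -/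
abbrev PlaneLine (K : Type*) [Field K] : Type _ := ℙ K (Fin 3 → K)

/-- A Hermitian polarity of the projective plane over a field `K` with `q ^ 2` elements: an
involutory correlation (a bijection from points to lines whose inverse is the associated map from
lines to points, so that incidence is reversed) which is induced by a nondegenerate Hermitian
form `(v, w) ↦ ∑ i j, v i * A i j * (w j) ^ q`. -/
structure HermitianPolarity (K : Type*) [Field K] (q : ℕ) where
  /-- the map `P ↦ P ^ ρ` from points to lines; `equiv.symm` is the map `ℓ ↦ ℓ ^ ρ` -/
  equiv : PlanePoint K ≃ PlaneLine K
  mem_comm : ∀ P Q : PlanePoint K, P ∈ equiv Q ↔ Q ∈ equiv P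
  exists_form : ∃ A : Matrix (Fin 3) (Fin 3) K, A.det ≠ 0 ∧ (∀ i j, A j i = A i j ^ q) ∧
    ∀ (v w : Fin 3 → K) (hv : v ≠ 0) (hw : w ≠ 0),
      Projectivization.mk K v hv ∈ equiv (Projectivization.mk K w hw) ↔
        v ⬝ᵥ (A *ᵥ fun j => w j ^ q) = 0

/-- A point-block structure: a set of points, and blocks that are sets of points.
(Abstract unitals are point-block structures.) -/
structure PointBlock (α : Type*) where
  points : Set α
  blocks : Set (Set α)
  subset_points : ∀ b ∈ blocks, b ⊆ points

namespace PointBlock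

variable {α : Type*} (U : PointBlock α)

/-- The set of full points with respect to `(b₁, b₂)`: the points `P` outside `b₁ ∪ b₂` such that
for each `Q ∈ b₁` the block connecting `P` and `Q` meets `b₂`. -/
def fullPoints (b₁ b₂ : Set α) : Set α :=
  {P | P ∈ U.points ∧ P ∉ b₁ ∪ b₂ ∧
    ∀ Q ∈ b₁, ∃ c ∈ U.blocks, P ∈ c ∧ Q ∈ c ∧ (c ∩ b₂).Nonempty}

/-- The blocks `b 0, …, b (k - 1)` form an embedded dual `k`-net: they are pairwise disjoint, and
the block through any two points on two different ones of them meets each of them in a point. -/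
def IsEmbeddedDualNet {k : ℕ} (b : Fin k → Set α) : Prop :=
  3 ≤ k ∧ (∀ i, b i ∈ U.blocks) ∧
    ∀ i j, i < j → Disjoint (b i) (b j) ∧
      ∀ P ∈ b i, ∀ Q ∈ b j, ∃ c ∈ U.blocks, P ∈ c ∧ Q ∈ c ∧ ∀ m, ∃ R, c ∩ b m = {R}

end PointBlock

namespace HermitianPolarity

variable {K : Type*} [Field K] {q : ℕ} (ρ : HermitianPolarity K q)

/-- Two lines are conjugate if the pole of the first lies on the second. -/
def ConjLines (ℓ m : PlaneLine K) : Prop := ρ.equiv.symm ℓ ∈ m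

/-- The set of self-conjugate points. -/
def selfConjPoints : Set (PlanePoint K) := {P | P ∈ ρ.equiv P}

/-- The set of self-conjugate points on a line. -/
def lineSection (ℓ : PlaneLine K) : Set (PlanePoint K) := {P | P ∈ ℓ ∧ P ∈ ρ.selfConjPoints}

/-- The Hermitian unital: its points are the self-conjugate points, its blocks are the subsets cut
out by the lines that are not self-conjugate. -/
def unital : PointBlock (PlanePoint K) where
  points := ρ.selfConjPoints
  blocks := {b | ∃ ℓ : PlaneLine K, ¬ ρ.ConjLines ℓ ℓ ∧ b = ρ.lineSection ℓ}
  subset_points := by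
    rintro b ⟨ℓ, -, rfl⟩ P hP
    exact hP.2

/-- In the Hermitian unital any two points are connected by exactly one block, so that "the block
connecting two points" in the definitions above is unambiguous. -/
theorem existsUnique_block {P Q : PlanePoint K} (hP : P ∈ ρ.unital.points)
    (hQ : Q ∈ ρ.unital.points) (hPQ : P ≠ Q) :
    ∃! c, c ∈ ρ.unital.blocks ∧ P ∈ c ∧ Q ∈ c := by
  classical
  obtain ⟨ℓ, ⟨hPl, hQl⟩, hu⟩ :=
    Configuration.HasLines.existsUnique_line (PlanePoint K) (PlaneLine K) P Q hPQ
  refine ⟨ρ.lineSection ℓ, ⟨⟨ℓ, fun h => ?_, rfl⟩, ⟨hPl, hP⟩, ⟨hQl, hQ⟩⟩, ?_⟩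
  · obtain ⟨R, rfl⟩ := ρ.equiv.surjective ℓ
    have hR : R ∈ ρ.equiv R := by simpa [ConjLines] using h
    have key : ∀ S, S ∈ ρ.equiv R → S ∈ ρ.equiv S → S = R := by
      intro S hS hSS
      by_contra hne
      rcases Configuration.Nondegenerate.eq_or_eq hS hR hSS ((ρ.mem_comm R S).2 hS) with h | h
      · exact hne h
      · exact hne (ρ.equiv.injective h).symm
    exact hPQ ((key P hPl hP).trans (key Q hQl hQ).symm)
  · rintro _ ⟨⟨m, -, rfl⟩, hPm, hQm⟩
    rw [hu m ⟨hPm.1, hQm.1⟩]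

end HermitianPolarity

/-!
Let `B` be the Hermitian form of `ρ`, with companion involution `σ : x ↦ x ^ q`, and call a vector
isotropic if it spans a self-conjugate point. Since `K` has characteristic two, `x + σ x = 0` means
that `x` is fixed by `σ`, and every element fixed by `σ` has exactly one square root, again fixed.

A point `P = ⟨p⟩` is full for the lines with poles `s₁, s₂` iff the projection from `P` maps the
isotropic points of the first line to isotropic points of the second. The image of `⟨r⟩` is
`⟨B r s₂ • p + B p s₂ • r⟩`, which is isotropic iff `B r s₂ * B s₂ p * B p r` is fixed by `σ`
(`exists_block_iff`). If the intersection of the two lines is not isotropic, there is an orthonormal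
frame `e 0, e 1, e 2` with `s₁ = e 0`, with `e 2` spanning the intersection and with
`s₂ = x • e 0 + y • e 1`, `y ≠ 0` (`exists_frame`). Testing the condition at `r = e 1 + u • e 2` for
three elements `u` of norm one shows that `P` is full iff `p = p₀ • e 0 + p₁ • e 1` is isotropic and
`x * σ y * σ p₀ * p₁` is fixed by `σ` (`mk_mem_fullPoints_iff`).

If the lines are conjugate, `x = 0` and every isotropic point of the line joining the poles is full
(`fullPoints_eq_lineSection`). Applied to all permutations of a self-polar triangle, this yields the
dual `3`-net (`isEmbeddedDualNet`). If `x ≠ 0`, uniqueness of square roots leaves exactly one full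
point (`ncard_fullPoints_eq_one`).
-/

/-! ### Finite fields of characteristic two with an involution -/

section Field

variable {K : Type*} [Field K]

theorem exists_eq_two_pow_of_card_eq_sq {q : ℕ} (hK : Nat.card K = q ^ 2) (hq : q ≠ 0)
    (hq_even : Even q) : ∃ n, n ≠ 0 ∧ q = 2 ^ n ∧ CharP K 2 := by
  have hcard : Nat.card K ≠ 0 := by rw [hK]; positivity
  have : Finite K := Nat.finite_of_card_ne_zero hcard
  have := Fintype.ofFinite K
  obtain ⟨p, hp⟩ := CharP.exists K
  obtain ⟨m, hp', hm⟩ := FiniteField.card K p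
  rw [← Nat.card_eq_fintype_card, hK] at hm
  have h2 : 2 ∣ p ^ (m : ℕ) := hm ▸ dvd_pow hq_even.two_dvd two_ne_zero
  obtain rfl : 2 = p := (Nat.prime_dvd_prime_iff_eq Nat.prime_two hp').1
    (Nat.prime_two.dvd_of_dvd_pow h2)
  obtain ⟨n, -, rfl⟩ := (Nat.dvd_prime_pow Nat.prime_two).1
    ((dvd_pow_self q two_ne_zero).trans hm.dvd)
  refine ⟨n, ?_, rfl, hp⟩
  rintro rfl
  exact absurd hq_even (by decide)

theorem exists_norm_one_ne_one {q : ℕ} (hK : Nat.card K = q ^ 2) (hq : 1 < q) {σ : K →+* K}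
    (hσ : ∀ x, σ x = x ^ q) (hσσ : ∀ x, σ (σ x) = x) : ∃ w : K, w * σ w = 1 ∧ w ≠ 1 := by
  have : Finite K := Nat.finite_of_card_ne_zero (by rw [hK]; positivity)
  have := Fintype.ofFinite K
  obtain ⟨x, hx⟩ : ∃ x : K, σ x ≠ x := by
    by_contra! h
    have h1 : Finset.univ.val ⊆ (Polynomial.X ^ q - Polynomial.X : Polynomial K).roots := by
      intro x _
      rw [Polynomial.mem_roots (FiniteField.X_pow_card_sub_X_ne_zero K hq)]
      simp [← hσ, h]
    have h2 := (Multiset.card_le_card ((Multiset.le_iff_subset Finset.univ.nodup).2 h1)).trans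
      (Polynomial.card_roots' _)
    rw [FiniteField.X_pow_card_sub_X_natDegree_eq K hq, Finset.card_val, Finset.card_univ,
      ← Nat.card_eq_fintype_card, hK] at h2
    nlinarith
  have hx0 : x ≠ 0 := by rintro rfl; simp at hx
  have hx1 : σ x ≠ 0 := by simpa using hx0
  -- Hilbert 90: `σ x / x` has norm one.
  refine ⟨σ x / x, ?_, ?_⟩
  · rw [map_div₀, hσσ]; field_simp
  · rwa [Ne, div_eq_one_iff_eq hx0]

theorem exists_fixed_sqrt [Finite K] [CharP K 2] {σ : K →+* K} {c : K} (hc : σ c = c) :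
    ∃ d, σ d = d ∧ d * d = c := by
  obtain ⟨d, hd⟩ := surjective_frobenius K 2 c
  rw [frobenius_def] at hd
  refine ⟨d, ?_, by rw [← hd, sq]⟩
  apply CharTwo.sq_injective
  simp only
  rw [← map_pow, hd, hc]

/-- Write `T x = x + σ x`, which is zero iff `σ x = x`. If `T (a + σ u * b) = 0` for every `u` of
norm one, then `b = 0` and `T a = 0`; three such `u`, namely `1`, `w` and `σ w = w⁻¹`, suffice.
This plays the role of the fact that a Hermitian form in two variables is determined, up to a
scalar, by its isotropic points. -/
theorem eq_of_three_traces [CharP K 2] {σ : K →+* K} (hσσ : ∀ x, σ (σ x) = x) {w : K}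
    (hw : w * σ w = 1) (hw1 : w ≠ 1) {a b : K} (h : ∀ u, u * σ u = 1 →
      (a + σ u * b) + σ (a + σ u * b) = 0) : b = 0 ∧ σ a = a := by
  have h1 := h 1 (by simp)
  have h2 := h w hw
  have h3 := h (σ w) (by rw [hσσ, mul_comm, hw])
  simp only [map_add, map_mul, hσσ, map_one, one_mul] at h1 h2 h3
  have hw' : w + 1 ≠ 0 := by rwa [Ne, CharTwo.add_eq_zero]
  have e1 : b + w * σ b = 0 := by
    apply (mul_eq_zero.1 (?_ : (w + 1) * (b + w * σ b) = 0)).resolve_left hw'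
    linear_combination w * (h1 + h2) - b * hw - (a + σ a) * w * CharTwo.two_eq_zero (R := K)
  have e2 : w * b + σ b = 0 := by
    apply (mul_eq_zero.1 (?_ : (w + 1) * (w * b + σ b) = 0)).resolve_left hw'
    linear_combination w * (h1 + h3) - σ b * hw - (a + σ a) * w * CharTwo.two_eq_zero (R := K)
  have hb : b = 0 := by
    have : (w + 1) ^ 2 * b = 0 := by
      linear_combination w * e2 - e1 + (w + 1) * b * CharTwo.two_eq_zero (R := K)
    exact (mul_eq_zero.1 this).resolve_left (pow_ne_zero _ hw')
  subst hb
  refine ⟨rfl, ?_⟩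
  rw [← CharTwo.add_eq_zero]
  simpa [add_comm] using h1

end Field

/-! ### The Hermitian form of a polarity -/

section Form

variable {K : Type*} [Field K] {q : ℕ}

/-- The sesquilinear form `B`, with companion automorphism `σ`, is Hermitian and induces `ρ`. -/
structure HermitianPolarity.IsForm (ρ : HermitianPolarity K q) {σ : K →+* K}
    (B : (Fin 3 → K) →ₗ[K] (Fin 3 → K) →ₛₗ[σ] K) : Prop where
  invol : ∀ x, σ (σ x) = x
  symm : ∀ v w, σ (B v w) = B w v
  mk_mem : ∀ {v w : Fin 3 → K} (hv : v ≠ 0) (hw : w ≠ 0),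
    Projectivization.mk K v hv ∈ ρ.equiv (Projectivization.mk K w hw) ↔ B v w = 0

theorem HermitianPolarity.exists_isForm (ρ : HermitianPolarity K q) (hK : Nat.card K = q ^ 2)
    {n : ℕ} (hq : q = 2 ^ n) [CharP K 2] :
    ∃ (σ : K →+* K) (B : (Fin 3 → K) →ₗ[K] (Fin 3 → K) →ₛₗ[σ] K),
      (∀ x, σ x = x ^ q) ∧ ρ.IsForm B := by
  have : Finite K := Nat.finite_of_card_ne_zero (by rw [hK, hq]; positivity)
  have := Fintype.ofFinite K
  have hσ : ∀ x : K, iterateFrobenius K 2 n x = x ^ q := fun x => by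
    rw [iterateFrobenius_def, hq]
  have hqq : ∀ x : K, (x ^ q) ^ q = x := fun x => by
    rw [← pow_mul, ← sq, ← hK, Nat.card_eq_fintype_card, FiniteField.pow_card]
  obtain ⟨A, -, hA, hmem⟩ := ρ.exists_form
  refine ⟨iterateFrobenius K 2 n, LinearMap.mk₂'ₛₗ (RingHom.id K) (iterateFrobenius K 2 n)
    (fun v w => v ⬝ᵥ (A *ᵥ fun j => iterateFrobenius K 2 n (w j))) ?_ ?_ ?_ ?_, hσ, ?_, ?_, ?_⟩
  · intro a b c; rw [add_dotProduct]
  · intro c a b; rw [smul_dotProduct, RingHom.id_apply]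
  · intro a b c
    rw [← dotProduct_add, ← Matrix.mulVec_add]
    congr 2
    funext j; simp
  · intro c a b
    rw [← dotProduct_smul, ← Matrix.mulVec_smul]
    congr 2
    funext j; simp
  · intro x; rw [hσ, hσ, hqq]
  · intro v w
    have hA' : ∀ i j, iterateFrobenius K 2 n (A i j) = A j i := fun i j => by rw [hσ, ← hA]
    simp only [LinearMap.mk₂'ₛₗ_apply, dotProduct, Matrix.mulVec, map_sum, map_mul, hA',
      Finset.mul_sum]
    rw [Finset.sum_comm]
    refine Finset.sum_congr rfl fun i _ => Finset.sum_congr rfl fun j _ => ?_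
    have hii : iterateFrobenius K 2 n (iterateFrobenius K 2 n (w i)) = w i := by
      rw [hσ, hσ, hqq]
    rw [hii]
    ring
  · intro v w hv hw
    rw [hmem]
    simp only [LinearMap.mk₂'ₛₗ_apply, hσ]

namespace HermitianPolarity.IsForm

variable {ρ : HermitianPolarity K q} {σ : K →+* K}
  {B : (Fin 3 → K) →ₗ[K] (Fin 3 → K) →ₛₗ[σ] K} (hB : ρ.IsForm B)
include hB

theorem symm_eq_zero {v w : Fin 3 → K} (h : B v w = 0) : B w v = 0 := by
  rw [← hB.symm, h, map_zero]

/-- The form is nondegenerate because no line contains all points. -/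
theorem eq_zero_of_forall {w : Fin 3 → K} (h : ∀ v, B v w = 0) : w = 0 := by
  by_contra hw
  obtain ⟨P, hP⟩ := Configuration.Nondegenerate.exists_point (P := PlanePoint K)
    (ρ.equiv (Projectivization.mk K w hw))
  induction P using Projectivization.ind with
  | h v hv => exact hP ((hB.mk_mem hv hw).2 (h v))

theorem linearIndependent {s t f : Fin 3 → K} (hs : B s s ≠ 0) (ht : B t t ≠ 0)
    (hts : B t s = 0) (hfs : B f s = 0) (hft : B f t = 0) (hf : f ≠ 0) :
    LinearIndependent K ![s, t, f] := by
  have hst := hB.symm_eq_zero hts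
  rw [Fintype.linearIndependent_iff]
  intro g hg
  simp only [Fin.sum_univ_three, Matrix.cons_val] at hg
  have h0 : g 0 = 0 := by
    have := congrArg (fun x => B x s) hg
    simpa [hts, hfs, hs] using this
  have h1 : g 1 = 0 := by
    have := congrArg (fun x => B x t) hg
    simpa [hst, hft, ht] using this
  have h2 : g 2 = 0 := by simpa [h0, h1, hf] using hg
  intro i; fin_cases i <;> assumption

/-- The point orthogonal to two orthogonal anisotropic points is anisotropic: otherwise it would be
orthogonal to a basis. -/
theorem apply_self_ne_zero {s t f : Fin 3 → K} (hs : B s s ≠ 0) (ht : B t t ≠ 0)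
    (hts : B t s = 0) (hfs : B f s = 0) (hft : B f t = 0) (hf : f ≠ 0) : B f f ≠ 0 := by
  intro hff
  refine hf (hB.eq_zero_of_forall fun v => ?_)
  have : B.flip f = 0 := by
    refine (basisOfLinearIndependentOfCardEqFinrank
      (hB.linearIndependent hs ht hts hfs hft hf) (by simp)).ext fun i => ?_
    fin_cases i <;> simp [hff, hB.symm_eq_zero hfs, hB.symm_eq_zero hft]
  simpa using congrArg (fun g => g v) this

/-- A point that is not self-conjugate is spanned by a unit vector: in characteristic two the value
`B v v` is the square, hence the norm, of an element fixed by `σ`. -/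
theorem exists_mk_eq [Finite K] [CharP K 2] {P : PlanePoint K} (hP : P ∉ ρ.equiv P) :
    ∃ (v : Fin 3 → K) (hv : v ≠ 0), P = Projectivization.mk K v hv ∧ B v v = 1 := by
  induction P using Projectivization.ind with
  | h v hv =>
    rw [hB.mk_mem] at hP
    obtain ⟨d, hd, hdd⟩ := exists_fixed_sqrt (hB.symm v v)
    have hd0 : d ≠ 0 := by rintro rfl; simp [← hdd] at hP
    refine ⟨d⁻¹ • v, smul_ne_zero (inv_ne_zero hd0) hv, ?_, ?_⟩
    · rw [Projectivization.mk_eq_mk_iff']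
      exact ⟨d, by rw [smul_smul, mul_inv_cancel₀ hd0, one_smul]⟩
    · simp [hd, ← hdd]
      field_simp

end HermitianPolarity.IsForm
end Form

/-! ### Orthonormal frames -/

section Frame

variable {K : Type*} [Field K] {q : ℕ}

/-- The vectors `e 0, e 1, e 2` are orthonormal for the sesquilinear form `B`. -/
def IsOrthonormalFrame {σ : K →+* K} (B : (Fin 3 → K) →ₗ[K] (Fin 3 → K) →ₛₗ[σ] K)
    (e : Fin 3 → Fin 3 → K) : Prop :=
  ∀ i j, B (e i) (e j) = if i = j then 1 else 0

namespace HermitianPolarity.IsForm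

variable {ρ : HermitianPolarity K q} {σ : K →+* K}
  {B : (Fin 3 → K) →ₗ[K] (Fin 3 → K) →ₛₗ[σ] K} (hB : ρ.IsForm B)

include hB in
/-- Two orthogonal unit vectors extend to an orthonormal frame, of which they are the outer
members. -/
theorem exists_frame [Finite K] [CharP K 2] {s f : Fin 3 → K} (hs : B s s = 1) (hf : B f f = 1)
    (hfs : B f s = 0) : ∃ e, IsOrthonormalFrame B e ∧ e 0 = s ∧ e 2 = f := by
  classical
  have hs0 : s ≠ 0 := by rintro rfl; simp at hs
  have hf0 : f ≠ 0 := by rintro rfl; simp at hf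
  have hne : ρ.equiv (.mk K s hs0) ≠ ρ.equiv (.mk K f hf0) := by
    intro h
    have := (hB.mk_mem hf0 hs0).2 hfs
    rw [h, hB.mk_mem, hf] at this
    exact one_ne_zero this
  obtain ⟨E, ⟨hE1, hE2⟩, -⟩ :=
    Configuration.HasPoints.existsUnique_point (PlanePoint K) (PlaneLine K) _ _ hne
  have hE : E ∉ ρ.equiv E := by
    induction E using Projectivization.ind with
    | h e he =>
      rw [hB.mk_mem] at hE1 hE2 ⊢
      exact hB.apply_self_ne_zero (by simp [hs]) (by simp [hf]) hfs hE1 hE2 he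
  obtain ⟨e, he, rfl, hee⟩ := hB.exists_mk_eq hE
  rw [hB.mk_mem] at hE1 hE2
  refine ⟨![s, e, f], ?_, rfl, rfl⟩
  intro i j
  fin_cases i <;> fin_cases j <;> simp [*, hB.symm_eq_zero hE1, hB.symm_eq_zero hE2,
    hB.symm_eq_zero hfs]

variable {e : Fin 3 → Fin 3 → K} (he : IsOrthonormalFrame B e)

include he in
theorem _root_.IsOrthonormalFrame.ne_zero (i : Fin 3) : e i ≠ 0 := by
  intro h
  simpa [h] using he i i

include hB he in
theorem eq_sum (v : Fin 3 → K) : v = B v (e 0) • e 0 + B v (e 1) • e 1 + B v (e 2) • e 2 := by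
  have hli := hB.linearIndependent (s := e 0) (t := e 1) (f := e 2) (by simp [he _ _])
    (by simp [he _ _]) (by simp [he _ _]) (by simp [he _ _]) (by simp [he _ _]) (he.ne_zero 2)
  have h := (basisOfLinearIndependentOfCardEqFinrank hli (by simp)).sum_repr v
  simp only [Fin.sum_univ_three, coe_basisOfLinearIndependentOfCardEqFinrank,
    Matrix.cons_val] at h
  rw [← h]
  simp [he _ _]

include hB he in
theorem apply_eq (v w : Fin 3 → K) : B v w =
    B v (e 0) * σ (B w (e 0)) + B v (e 1) * σ (B w (e 1)) + B v (e 2) * σ (B w (e 2)) := by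
  conv_lhs => rw [hB.eq_sum he v]
  simp [hB.symm]

end HermitianPolarity.IsForm
end Frame

/-! ### Full points in coordinates -/

section Full

variable {K : Type*} [Field K] {q : ℕ}

namespace HermitianPolarity.IsForm

variable {ρ : HermitianPolarity K q} {σ : K →+* K}
  {B : (Fin 3 → K) →ₗ[K] (Fin 3 → K) →ₛₗ[σ] K} (hB : ρ.IsForm B)
include hB

theorem mk_mem_lineSection {v w : Fin 3 → K} (hv : v ≠ 0) (hw : w ≠ 0) :
    Projectivization.mk K v hv ∈ ρ.lineSection (ρ.equiv (.mk K w hw)) ↔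
      B v w = 0 ∧ B v v = 0 := by
  rw [← hB.mk_mem hv hw, ← hB.mk_mem hv hv]; rfl

/-- The line joining the isotropic points `p` and `r` meets the polar line of `s` in the point
`B r s • p + B p s • r` (signs do not matter), which is isotropic iff
`B r s * B s p * B p r` has trace zero. -/
theorem exists_block_iff [CharP K 2] {p r s : Fin 3 → K} (hp : p ≠ 0) (hr : r ≠ 0) (hs : s ≠ 0)
    (hpp : B p p = 0) (hrr : B r r = 0) (hps : B p s ≠ 0)
    (hpr : Projectivization.mk K p hp ≠ .mk K r hr) :
    (∃ c ∈ ρ.unital.blocks, Projectivization.mk K p hp ∈ c ∧ Projectivization.mk K r hr ∈ c ∧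
      (c ∩ ρ.lineSection (ρ.equiv (.mk K s hs))).Nonempty) ↔
    B r s * B s p * B p r + σ (B r s * B s p * B p r) = 0 := by
  have ht : B r s • p + B p s • r ≠ 0 := by
    intro h
    refine hpr ((Projectivization.mk_eq_mk_iff' K _ _ hr hp).2 ⟨-((B p s)⁻¹ * B r s), ?_⟩).symm
    rw [neg_smul, mul_smul, eq_neg_of_add_eq_zero_left h, smul_neg, neg_neg, smul_smul,
      inv_mul_cancel₀ hps, one_smul]
  have hts : B (B r s • p + B p s • r) s = 0 := by
    simp [mul_comm (B r s), CharTwo.add_self_eq_zero]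
  have htt : B (B r s • p + B p s • r) (B r s • p + B p s • r) =
      B r s * B s p * B p r + σ (B r s * B s p * B p r) := by
    simp [hpp, hrr, hB.symm]
    ring
  rw [← htt]
  constructor
  · rintro ⟨_, ⟨ℓ, hℓ, rfl⟩, hpc, hrc, R, hR, hR'⟩
    obtain ⟨M, rfl⟩ := ρ.equiv.surjective ℓ
    induction M using Projectivization.ind with
    | h m hm =>
    rw [hB.mk_mem_lineSection] at hpc hrc
    have htm : B (B r s • p + B p s • r) m = 0 := by simp [hpc.1, hrc.1]
    rcases Configuration.Nondegenerate.eq_or_eq hR.1 ((hB.mk_mem ht hm).2 htm) hR'.1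
      ((hB.mk_mem ht hs).2 hts) with h | h
    · rw [h, hB.mk_mem_lineSection] at hR
      exact hR.2
    · have := (hB.mk_mem hp hm).2 hpc.1
      rw [h, hB.mk_mem] at this
      exact absurd this hps
  · intro h
    obtain ⟨c, ⟨⟨ℓ, hℓ, rfl⟩, hpc, hrc⟩, -⟩ := ρ.existsUnique_block (P := .mk K p hp)
      (Q := .mk K r hr) ((hB.mk_mem hp hp).2 hpp) ((hB.mk_mem hr hr).2 hrr) hpr
    refine ⟨_, ⟨ℓ, hℓ, rfl⟩, hpc, hrc, ?_⟩
    obtain ⟨M, rfl⟩ := ρ.equiv.surjective ℓ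
    induction M using Projectivization.ind with
    | h m hm =>
    rw [hB.mk_mem_lineSection] at hpc hrc
    have htm : B (B r s • p + B p s • r) m = 0 := by simp [hpc.1, hrc.1]
    exact ⟨.mk K _ ht, (hB.mk_mem_lineSection ht hm).2 ⟨htm, h⟩,
      (hB.mk_mem_lineSection ht hs).2 ⟨hts, h⟩⟩

/-- Full points with respect to the polar lines of `e 0` and of `s = x • e 0 + y • e 1`, where
`y ≠ 0`: they are the isotropic points `p = p₀ • e 0 + p₁ • e 1` for which `x * σ y * σ p₀ * p₁` is
fixed by `σ`. Here `e 2` spans the intersection of the two lines, and the isotropic points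
`e 1 + u • e 2` of the first line, with `u` of norm one, force `p` to be orthogonal to `e 2`. -/
theorem mk_mem_fullPoints_iff [CharP K 2] {e : Fin 3 → Fin 3 → K} (he : IsOrthonormalFrame B e)
    {w : K} (hw : w * σ w = 1) (hw1 : w ≠ 1) {s : Fin 3 → K} (hs : s ≠ 0)
    (hss : B s s ≠ 0) (hs2 : B s (e 2) = 0) (hs1 : B s (e 1) ≠ 0) {p : Fin 3 → K} (hp : p ≠ 0) :
    Projectivization.mk K p hp ∈ ρ.unital.fullPoints
      (ρ.lineSection (ρ.equiv (.mk K (e 0) (he.ne_zero 0))))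
      (ρ.lineSection (ρ.equiv (.mk K s hs))) ↔
    B p p = 0 ∧ B p (e 2) = 0 ∧
      σ (B s (e 0) * σ (B s (e 1)) * σ (B p (e 0)) * B p (e 1)) =
        B s (e 0) * σ (B s (e 1)) * σ (B p (e 0)) * B p (e 1) := by
  have hmem : Projectivization.mk K p hp ∈ ρ.unital.points ↔ B p p = 0 := hB.mk_mem hp hp
  simp only [PointBlock.fullPoints, Set.mem_ofPred_eq, hmem, Set.mem_union,
    hB.mk_mem_lineSection, not_or]
  refine and_congr_right fun hpp => ?_
  simp only [hpp, and_true]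
  have hpp' := hB.apply_eq he p p
  have hss' := hB.apply_eq he s s
  have hsp := hB.apply_eq he s p
  have hps := hB.apply_eq he p s
  rw [hs2] at hss' hsp hps
  rw [hpp] at hpp'
  rw [hss'] at hss
  constructor
  · rintro ⟨⟨hp0, hps0⟩, h⟩
    have key := eq_of_three_traces hB.invol hw hw1
      (a := σ (B s (e 1)) * B s p * B p (e 1)) (b := σ (B s (e 1)) * B s p * B p (e 2)) ?_
    · have hsp0 : B s p ≠ 0 := fun h => hps0 (hB.symm_eq_zero h)
      have h2 : B p (e 2) = 0 := by simpa [hs1, hsp0] using key.1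
      refine ⟨h2, ?_⟩
      have h3 := key.2
      rw [hsp] at h3
      simp only [h2, map_mul, map_add, map_zero, hB.invol] at h3 ⊢
      linear_combination h3
    · intro u hu
      have hr : e 1 + u • e 2 ≠ 0 := by
        intro h
        have := congrArg (fun v => B v (e 1)) h
        simp [he _ _] at this
      have hrr : B (e 1 + u • e 2) (e 1 + u • e 2) = 0 := by
        simp [he _ _, hu, CharTwo.add_self_eq_zero]
      have hr0 : B (e 1 + u • e 2) (e 0) = 0 := by simp [he _ _]
      have hpr : Projectivization.mk K p hp ≠ .mk K _ hr := by
        intro h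
        apply hp0
        rw [← hB.mk_mem hp (he.ne_zero 0), h, hB.mk_mem, hr0]
      have h' := (hB.exists_block_iff hp hr hs hpp hrr hps0 hpr).1
        (h _ ((hB.mk_mem_lineSection _ _).2 ⟨hr0, hrr⟩))
      have e1 : B (e 1 + u • e 2) s = σ (B s (e 1)) := by
        simp [hB.symm, hB.symm_eq_zero hs2]
      have e2 : B p (e 1 + u • e 2) = B p (e 1) + σ u * B p (e 2) := by simp
      rw [e1, e2] at h'
      convert h' using 3 <;> ring
  · rintro ⟨h2, h3⟩
    rw [h2] at hpp' hsp hps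
    simp only [map_zero, mul_zero, add_zero] at hpp' hss hsp hps
    have hN : B p (e 0) * σ (B p (e 0)) = B p (e 1) * σ (B p (e 1)) :=
      CharTwo.add_eq_zero.1 hpp'.symm
    have hp0 : B p (e 0) ≠ 0 := by
      intro h0
      have h1 : B p (e 1) = 0 := by simpa [h0] using hN
      exact hp (by rw [hB.eq_sum he p, h0, h1, h2]; simp)
    -- If `p` were on the second line, `s` would be isotropic, as `B p (e 0)` and `B p (e 1)` have
    -- the same norm.
    have hps0 : B p s ≠ 0 := by
      rw [hps, Ne, CharTwo.add_eq_zero]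
      intro h
      have h' := congrArg σ h
      simp only [map_mul, hB.invol] at h'
      refine hss (CharTwo.add_eq_zero.2 ?_)
      have hp0' : σ (B p (e 0)) ≠ 0 := by simpa using hp0
      apply mul_left_cancel₀ (mul_ne_zero hp0 hp0')
      linear_combination σ (B p (e 0)) * B s (e 0) * h + B p (e 1) * σ (B s (e 1)) * h'
        - B s (e 1) * σ (B s (e 1)) * hN
    -- Every isotropic `r` orthogonal to `e 0` has `B r s * B s p * B p r` equal to the norm of
    -- `B r (e 1)` times `σ (B s (e 1)) * B s p * B p (e 1)`, which is fixed by `σ`.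
    refine ⟨⟨hp0, hps0⟩, fun Q hQ => ?_⟩
    induction Q using Projectivization.ind with
    | h r hr =>
    rw [hB.mk_mem_lineSection] at hQ
    obtain ⟨hr0, hrr⟩ := hQ
    have hpr : Projectivization.mk K p hp ≠ .mk K _ hr := by
      intro h
      apply hp0
      rw [← hB.mk_mem hp (he.ne_zero 0), h, hB.mk_mem, hr0]
    rw [hB.exists_block_iff hp hr hs hpp hrr hps0 hpr, CharTwo.add_eq_zero]
    rw [hB.apply_eq he r s, hB.apply_eq he p r, hr0, h2, hs2, hsp]
    simp only [map_mul, map_add, map_zero, hB.invol] at h3 ⊢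
    linear_combination -(B r (e 1) * σ (B r (e 1)) * h3)

end HermitianPolarity.IsForm
end Full

/-! ### Conjugate and non-conjugate pairs of blocks -/

section Triangle

variable {K : Type*} [Field K] {q : ℕ}

namespace HermitianPolarity

variable {ρ : HermitianPolarity K q}

theorem conjLines_equiv_iff {P Q : PlanePoint K} :
    ρ.ConjLines (ρ.equiv P) (ρ.equiv Q) ↔ P ∈ ρ.equiv Q := by
  simp [ConjLines]

section

variable {σ : K →+* K} {B : (Fin 3 → K) →ₗ[K] (Fin 3 → K) →ₛₗ[σ] K} [Finite K] [CharP K 2]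
  {w : K}

/-- For a self-polar triangle `P, Q, R` the coordinate `B Q P` is zero, so that the condition in
`mk_mem_fullPoints_iff` reduces to isotropy on the polar line of `R`. -/
theorem IsForm.fullPoints_eq_lineSection (hB : ρ.IsForm B) (hw : w * σ w = 1) (hw1 : w ≠ 1)
    {P Q R : PlanePoint K} (hP : P ∉ ρ.equiv P) (hQ : Q ∉ ρ.equiv Q) (hR : R ∉ ρ.equiv R)
    (hQP : Q ∈ ρ.equiv P) (hRP : R ∈ ρ.equiv P) (hQR : Q ∈ ρ.equiv R) :
    ρ.unital.fullPoints (ρ.lineSection (ρ.equiv P)) (ρ.lineSection (ρ.equiv Q)) =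
      ρ.lineSection (ρ.equiv R) := by
  obtain ⟨s, hs0, rfl, hs⟩ := hB.exists_mk_eq hP
  obtain ⟨t, ht0, rfl, ht⟩ := hB.exists_mk_eq hQ
  obtain ⟨f, hf0, rfl, hf⟩ := hB.exists_mk_eq hR
  rw [hB.mk_mem] at hQP hRP hQR
  obtain ⟨e, he, rfl, rfl⟩ := hB.exists_frame hs hf hRP
  have ht1 : B t (e 1) ≠ 0 := by
    intro h
    have := hB.apply_eq he t t
    simp [ht, h, hQP, hQR] at this
  ext X
  induction X using Projectivization.ind with
  | h p hp =>
  rw [hB.mk_mem_fullPoints_iff he hw hw1 ht0 (by simp [ht]) hQR ht1 hp,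
    hB.mk_mem_lineSection hp hf0, hQP]
  simp [and_comm]

omit [Finite K] [CharP K 2] in
theorem IsForm.notMem_of_mem_of_mem (hB : ρ.IsForm B) {P Q S : PlanePoint K}
    (hP : P ∉ ρ.equiv P) (hQ : Q ∉ ρ.equiv Q) (hQP : Q ∈ ρ.equiv P) (hSP : S ∈ ρ.equiv P)
    (hSQ : S ∈ ρ.equiv Q) : S ∉ ρ.equiv S := by
  induction P using Projectivization.ind with | h p hp =>
  induction Q using Projectivization.ind with | h r hr =>
  induction S using Projectivization.ind with | h s hs =>
  rw [hB.mk_mem] at *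
  exact hB.apply_self_ne_zero hP hQ hQP hSP hSQ hs

/-- Let `S` be any point of the polar line of `P`. If `S` is not itself in the section, then
`e 1 + e 2` spans a point of it, in a frame with `e 0` and `e 2` spanning `P` and `S`. -/
theorem IsForm.lineSection_nonempty (hB : ρ.IsForm B) {P : PlanePoint K}
    (hP : P ∉ ρ.equiv P) : (ρ.lineSection (ρ.equiv P)).Nonempty := by
  classical
  have hne : ∃ Q, Q ≠ P := by
    obtain ⟨p₁, p₂, p₃, l₁, l₂, l₃, h⟩ :=
      Configuration.ProjectivePlane.exists_config (P := PlanePoint K) (L := PlaneLine K)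
    by_contra! hall
    rw [hall p₁, hall p₂, hall p₃] at h
    tauto
  obtain ⟨Q, hQ⟩ := hne
  obtain ⟨S, ⟨hS, -⟩, -⟩ := Configuration.HasPoints.existsUnique_point (PlanePoint K)
    (PlaneLine K) _ _ (ρ.equiv.injective.ne hQ.symm)
  by_cases hSS : S ∈ ρ.equiv S
  · exact ⟨S, hS, hSS⟩
  obtain ⟨s, hs0, rfl, hs⟩ := hB.exists_mk_eq hP
  obtain ⟨f, hf0, rfl, hf⟩ := hB.exists_mk_eq hSS
  rw [hB.mk_mem] at hS
  obtain ⟨e, he, rfl, rfl⟩ := hB.exists_frame hs hf hS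
  have h0 : e 1 + e 2 ≠ 0 := by
    intro h
    have := congrArg (fun v => B v (e 1)) h
    simp [he _ _] at this
  exact ⟨.mk K _ h0, (hB.mk_mem_lineSection h0 hs0).2
    ⟨by simp [he _ _], by simp [he _ _, CharTwo.add_self_eq_zero]⟩⟩

/-- Two lines with poles `P, Q` that are not conjugate and meet in a point `S` outside the unital
have a single full point. In an orthonormal frame with `P = e 0`, `S = e 2` and
`Q = x • e 0 + y • e 1`, a full point `e 0 + p₁ • e 1` has `p₁` of norm one and `d = x * σ y * p₁`
fixed by `σ`. So `d ^ 2` is the product of the norms of `x` and `y`, and in characteristic two this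
determines `d`. -/
theorem IsForm.ncard_fullPoints_eq_one (hB : ρ.IsForm B) (hw : w * σ w = 1) (hw1 : w ≠ 1)
    {P Q S : PlanePoint K} (hP : P ∉ ρ.equiv P) (hQ : Q ∉ ρ.equiv Q) (hS : S ∉ ρ.equiv S)
    (hne : Q ≠ P) (hQP : Q ∉ ρ.equiv P) (hSP : S ∈ ρ.equiv P) (hQS : Q ∈ ρ.equiv S) :
    (ρ.unital.fullPoints (ρ.lineSection (ρ.equiv P)) (ρ.lineSection (ρ.equiv Q))).ncard = 1 := by
  obtain ⟨s, hs0, rfl, hs⟩ := hB.exists_mk_eq hP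
  obtain ⟨t, ht0, rfl, ht⟩ := hB.exists_mk_eq hQ
  obtain ⟨f, hf0, rfl, hf⟩ := hB.exists_mk_eq hS
  rw [hB.mk_mem] at hQP hSP hQS
  obtain ⟨e, he, rfl, rfl⟩ := hB.exists_frame hs hf hSP
  have ht1 : B t (e 1) ≠ 0 := by
    intro h
    refine hne ((Projectivization.mk_eq_mk_iff' K _ _ ht0 hs0).2 ⟨B t (e 0), ?_⟩)
    conv_rhs => rw [hB.eq_sum he t, h, hQS]
    simp
  set x := B t (e 0) with hx
  set y := B t (e 1) with hy
  have hx' : σ x ≠ 0 := by simpa using hQP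
  have hy' : σ y ≠ 0 := by simpa using ht1
  obtain ⟨d, hd, hdd⟩ := exists_fixed_sqrt (σ := σ) (c := x * σ x * (y * σ y)) (by
    simp only [map_mul, hB.invol]; ring)
  have hdN : d / (x * σ y) * (d / (σ x * y)) = 1 := by
    rw [div_mul_div_comm, hdd]
    field_simp
  have h0 : e 0 + (d / (x * σ y)) • e 1 ≠ 0 := by
    intro h
    have := congrArg (fun v => B v (e 0)) h
    simp [he _ _] at this
  rw [Set.ncard_eq_one]
  refine ⟨.mk K _ h0, Set.ext fun X => ?_⟩
  induction X using Projectivization.ind with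
  | h p hp =>
  rw [hB.mk_mem_fullPoints_iff he hw hw1 ht0 (by simp [ht]) hQS ht1 hp, Set.mem_singleton_iff,
    Projectivization.mk_eq_mk_iff' K _ _ hp h0, ← hx, ← hy]
  constructor
  · rintro ⟨hpp, hp2, hz⟩
    have hN : B p (e 0) * σ (B p (e 0)) = B p (e 1) * σ (B p (e 1)) := by
      rw [hB.apply_eq he, hp2, zero_mul, add_zero] at hpp
      exact CharTwo.add_eq_zero.1 hpp
    have hp0 : B p (e 0) ≠ 0 := by
      intro h0
      have h1 : B p (e 1) = 0 := by simpa [h0] using hN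
      exact hp (by rw [hB.eq_sum he p, h0, h1, hp2]; simp)
    have hp0' : σ (B p (e 0)) ≠ 0 := by simpa using hp0
    have hz' : x * σ y * σ (B p (e 0)) * B p (e 1) = d * (B p (e 0) * σ (B p (e 0))) := by
      apply CharTwo.sq_injective
      simp only [map_mul, hB.invol] at hz ⊢
      linear_combination (-x * σ y * σ (B p (e 0)) * B p (e 1)) * hz
        - x * σ x * y * σ y * B p (e 0) * σ (B p (e 0)) * hN
        - (B p (e 0) * σ (B p (e 0))) ^ 2 * hdd
    have h1 : B p (e 1) = B p (e 0) * (d / (x * σ y)) := by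
      field_simp
      apply mul_left_cancel₀ hp0'
      linear_combination hz'
    refine ⟨B p (e 0), ?_⟩
    conv_rhs => rw [hB.eq_sum he p, hp2, h1]
    simp [mul_smul]
  · rintro ⟨a, rfl⟩
    refine ⟨?_, by simp [he _ _], ?_⟩
    · simp only [map_add, map_smul, map_smulₛₗ, LinearMap.add_apply, LinearMap.smul_apply, he _ _,
        hd, hB.invol, map_div₀, map_mul, smul_eq_mul]
      simp only [reduceIte, zero_ne_one, one_ne_zero]
      linear_combination a * σ a * hdN + a * σ a * CharTwo.two_eq_zero (R := K)
    · simp [he _ _, hd, hB.invol]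
      field_simp

/-- The sides of a self-polar triangle cut out an embedded dual `3`-net: a point of one block is full
with respect to the other two, by `fullPoints_eq_lineSection`. -/
theorem IsForm.isEmbeddedDualNet (hB : ρ.IsForm B) (hw : w * σ w = 1) (hw1 : w ≠ 1)
    {P : Fin 3 → PlanePoint K} (hP : ∀ i j, P i ∈ ρ.equiv (P j) ↔ i ≠ j) :
    ρ.unital.IsEmbeddedDualNet fun i => ρ.lineSection (ρ.equiv (P i)) := by
  have hself : ∀ i, P i ∉ ρ.equiv (P i) := fun i => by simp [hP]
  have hthird : ∀ i j : Fin 3, ∃ k, k ≠ i ∧ k ≠ j := by decide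
  have hdisj : ∀ i j, i ≠ j →
      Disjoint (ρ.lineSection (ρ.equiv (P i))) (ρ.lineSection (ρ.equiv (P j))) := by
    intro i j hij
    obtain ⟨k, hki, hkj⟩ := hthird i j
    rw [Set.disjoint_left]
    intro R hRi hRj
    rcases Configuration.Nondegenerate.eq_or_eq hRi.1 ((hP k i).2 hki) hRj.1 ((hP k j).2 hkj)
      with rfl | h
    · exact hself k hRi.2
    · exact hself i (h ▸ (hP i j).2 hij)
  refine ⟨le_rfl, fun i => ⟨_, fun h => hself i (conjLines_equiv_iff.1 h), rfl⟩,
    fun i j hij => ⟨hdisj i j hij.ne, fun X hX Y hY => ?_⟩⟩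
  obtain ⟨k, hki, hkj⟩ := hthird i j
  have hX' := hX
  simp only at hX'
  rw [← hB.fullPoints_eq_lineSection hw hw1 (hself j) (hself k) (hself i) ((hP k j).2 hkj)
    ((hP i j).2 hij.ne) ((hP k i).2 hki)] at hX'
  obtain ⟨_, ⟨ℓ, hℓ, rfl⟩, hXc, hYc, hZ⟩ := hX'.2.2 Y hY
  refine ⟨_, ⟨ℓ, hℓ, rfl⟩, hXc, hYc, fun m => ?_⟩
  have hne : (ρ.lineSection ℓ ∩ ρ.lineSection (ρ.equiv (P m))).Nonempty := by
    have : m = i ∨ m = j ∨ m = k := by omega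
    rcases this with rfl | rfl | rfl
    exacts [⟨X, hXc, hX⟩, ⟨Y, hYc, hY⟩, hZ]
  obtain ⟨R, hR⟩ := hne
  refine ⟨R, Set.Subset.antisymm (fun R' hR' => ?_) (Set.singleton_subset_iff.2 hR)⟩
  rcases Configuration.Nondegenerate.eq_or_eq hR'.1.1 hR.1.1 hR'.2.1 hR.2.1 with h | rfl
  · exact h
  · by_cases hm : m = i
    · exact (Set.disjoint_left.1 (hdisj j m (hm ▸ hij.ne')) hY hYc).elim
    · exact (Set.disjoint_left.1 (hdisj i m (Ne.symm hm)) hX hXc).elim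

end

end HermitianPolarity
end Triangle

theorem proposition4 (K : Type*) [Field K] (q : ℕ) (hK : Nat.card K = q ^ 2) (hq : q ≠ 0)
    (hq_even : Even q) (ρ : HermitianPolarity K q) (ℓ₁ ℓ₂ : PlaneLine K)
    (h₁ : ¬ ρ.ConjLines ℓ₁ ℓ₁) (h₂ : ¬ ρ.ConjLines ℓ₂ ℓ₂) :
    (ρ.ConjLines ℓ₁ ℓ₂ →
      ∃ S : PlanePoint K, (∀ R : PlanePoint K, R ∈ ℓ₁ ∧ R ∈ ℓ₂ ↔ R = S) ∧
        ρ.unital.fullPoints (ρ.lineSection ℓ₁) (ρ.lineSection ℓ₂)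
          = ρ.lineSection (ρ.equiv S) ∧
        ρ.unital.IsEmbeddedDualNet
          ![ρ.lineSection ℓ₁, ρ.lineSection ℓ₂, ρ.lineSection (ρ.equiv S)]) ∧
    (¬ ρ.ConjLines ℓ₁ ℓ₂ →
      (ρ.lineSection ℓ₁ ∩ ρ.lineSection ℓ₂).Nonempty ∨
        (ρ.unital.fullPoints (ρ.lineSection ℓ₁) (ρ.lineSection ℓ₂)).ncard = 1) := by
  classical
  have : Finite K := Nat.finite_of_card_ne_zero (by rw [hK]; positivity)
  obtain ⟨n, hn, hqn, _⟩ := exists_eq_two_pow_of_card_eq_sq hK hq hq_even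
  obtain ⟨σ, B, hσ, hB⟩ := ρ.exists_isForm hK hqn
  obtain ⟨w, hw, hw1⟩ := exists_norm_one_ne_one hK (hqn ▸ Nat.one_lt_two_pow hn) hσ hB.invol
  obtain ⟨P, rfl⟩ := ρ.equiv.surjective ℓ₁
  obtain ⟨Q, rfl⟩ := ρ.equiv.surjective ℓ₂
  simp only [HermitianPolarity.conjLines_equiv_iff] at h₁ h₂ ⊢
  rcases eq_or_ne Q P with rfl | hne
  · refine ⟨fun h => absurd h h₁, fun _ => Or.inl ?_⟩
    rw [Set.inter_self]
    exact hB.lineSection_nonempty h₁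
  obtain ⟨S, ⟨hSP, hSQ⟩, hS⟩ := Configuration.HasPoints.existsUnique_point (PlanePoint K)
    (PlaneLine K) _ _ (ρ.equiv.injective.ne hne.symm)
  refine ⟨fun hPQ => ?_, fun hPQ => ?_⟩
  · have hQP := (ρ.mem_comm P Q).1 hPQ
    have hSS := hB.notMem_of_mem_of_mem h₁ h₂ hQP hSP hSQ
    have hPS := (ρ.mem_comm S P).1 hSP
    have hQS := (ρ.mem_comm S Q).1 hSQ
    refine ⟨S, fun R => ⟨hS R, ?_⟩, hB.fullPoints_eq_lineSection hw hw1 h₁ h₂ hSS hQP hSP hQS, ?_⟩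
    · rintro rfl
      exact ⟨hSP, hSQ⟩
    · convert hB.isEmbeddedDualNet hw hw1 (P := ![P, Q, S]) ?_ using 1
      · funext i
        fin_cases i <;> rfl
      · intro i j
        fin_cases i <;> fin_cases j <;> simp [*]
  · by_cases hSS : S ∈ ρ.equiv S
    · exact Or.inl ⟨S, ⟨hSP, hSS⟩, hSQ, hSS⟩
    · exact Or.inr (hB.ncard_fullPoints_eq_one hw hw1 h₁ h₂ hSS hne
        (fun h => hPQ ((ρ.mem_comm Q P).1 h)) hSP ((ρ.mem_comm S Q).1 hSQ))
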